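/- Let $Q$ be a real polynomial of degree $d$ with all coefficients non-zero and with all roots real (a hyperbolic polynomial). Its sign pattern is the sequence of signs of its coefficients, from the leading one to the constant term. For $n\ge 1$, denote by $\Sigma_{2,n,2}$ the sign pattern consisting of $2$ signs $+$, followed by $n$ signs $-$, followed by $2$ signs $+$ (so $d=n+3$); by Descartes' rule of signs a hyperbolic polynomial with this sign pattern has exactly two positive and $n+1$ negative roots. For non-negative integers $u,v,w$ with $u+v+w=n+1$, the couple $(\Sigma_{2,n,2},(u,v,w))$ is called realizable if there exists a hyperbolic polynomial with sign pattern $\Sigma_{2,n,2}$ whose positive roots $\beta<\alpha$ and whose moduli of negative roots $\gamma_1<\cdots<\gamma_{n+1}$ are all distinct and satisfy $\gamma_u<\beta<\gamma_{u+1}$ and $\gamma_{u+v}<\alpha<\gamma_{u+v+1}$, where $\gamma_0:=0$ and $\gamma_{n+2}:=+\infty$. Theorem. Let $n\ge 4$. (1) For all non-negative integers $u,v,w$ with $u+v+w=n+1$, $u\le 2$ and $w\le 2$, the couple $(\Sigma_{2,n,2},(u,v,w))$ is realizable. (2) For all non-negative integers $u,v,w$ with $u+v+w=n+1$ and with $u\ge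 3$ or $w\ge 3$, the couple $(\Sigma_{2,n,2},(u,v,w))$ is not realizable. -/

import Mathlib

open Polynomial

/-- A real polynomial is hyperbolic if all its (complex) roots are real. -/
def IsHyperbolic (Q : ℝ[X]) : Prop :=
  Q ≠ 0 ∧ ∀ z : ℂ, aeval z Q = 0 → z.im = 0

/-- The list of signs of the coefficients `a_d, a_{d-1}, …, a_0`, from the leading one down to
the constant term. -/
noncomputable def signPattern (Q : ℝ[X]) : List SignType :=
  Q.coeffList.map SignType.sign

/-- The sign pattern `Σ_{m,n,q}`: `m` signs `+`, followed by `n` signs `-`, followed by `q`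
signs `+`. -/
def sigmaPattern (m n q : ℕ) : List SignType :=
  List.replicate m 1 ++ List.replicate n (-1) ++ List.replicate q 1

/-- The roots of `Q`, counted with multiplicity, are two positive numbers `β < α` and
`u + v + w` negative numbers with moduli `γ 0 < γ 1 < ⋯`, all moduli being distinct. Exactly the
`u` smallest of the moduli of negative roots are smaller than `β`, and exactly the `u + v`
smallest ones are smaller than `α`. -/
def HasOrderOfModuli (Q : ℝ[X]) (u v w : ℕ) : Prop :=
  ∃ (β α : ℝ) (γ : Fin (u + v + w) → ℝ),
    0 < β ∧ β < α ∧ (∀ i, 0 < γ i) ∧ StrictMono γ ∧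
    Q.roots = α ::ₘ β ::ₘ Finset.univ.val.map (fun i => -γ i) ∧
    (∀ i : Fin (u + v + w), (i : ℕ) < u → γ i < β) ∧
    (∀ i : Fin (u + v + w), u ≤ (i : ℕ) → β < γ i) ∧
    (∀ i : Fin (u + v + w), (i : ℕ) < u + v → γ i < α) ∧
    (∀ i : Fin (u + v + w), u + v ≤ (i : ℕ) → α < γ i)

/-- The couple `(Σ_{m,n,q}, (u,v,w))` is realizable. -/
def IsRealizable (m n q u v w : ℕ) : Prop :=
  ∃ Q : ℝ[X], IsHyperbolic Q ∧ signPattern Q = sigmaPattern m n q ∧ HasOrderOfModuli Q u v w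

/-! Non-realizability uses only two coefficients. Since those of `X ^ (n + 1)` and `X ^ 2` are
negative, the second elementary symmetric function is negative both for the roots and for their
inverses. If three negative roots have moduli above `α`, these three, two further negative roots and
the two positive roots already give a contradiction (`five_moduli_nonneg`); the remaining negative
roots only strengthen it (`false_of_three_large_moduli`). Inverting all roots turns the case `3 ≤ u`
into `3 ≤ w`.

Realizability concatenates sign patterns across widely separated scales: a cubic with roots `1, -a,
-b`, then negative roots of small modulus, each lengthening the run of minus signs, and finally a
much smaller copy `ε, -ε a', -ε b'` of such a triple. Inside each triple the moduli may lie on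
either side of the positive root, which yields every `u, w ≤ 2`. -/

/-! ### Inequalities for five negative roots, normalised by `α = 1`. -/

theorem quadratic_nonneg_of_le {A B C t T : ℝ} (hA : 0 ≤ A) (hC : C ≤ 0) (ht : 0 ≤ t)
    (htT : t ≤ T) (hT : 0 ≤ A + B * T + C * T ^ 2) : 0 ≤ A + B * t + C * t ^ 2 := by
  rcases ht.eq_or_lt with rfl | ht
  · simpa using hA
  have hT0 : 0 < T := ht.trans_le htT
  -- By concavity, `T` times the value at `t` is `(T - t) A + t (A + B T + C T²) - C t T (T - t)`.
  have h : 0 ≤ T * (A + B * t + C * t ^ 2) := by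
    have h1 : 0 ≤ (T - t) * A := mul_nonneg (by linarith) hA
    have h2 : 0 ≤ t * (A + B * T + C * T ^ 2) := mul_nonneg ht.le hT
    have h3 : 0 ≤ (-C) * (t * T * (T - t)) :=
      mul_nonneg (by linarith) (mul_nonneg (by positivity) (by linarith))
    nlinarith
  exact nonneg_of_mul_nonneg_right h hT0

theorem boundary_poly_nonneg {y N : ℝ} (hy : 0 ≤ y) (hN : 0 ≤ N) (hN2 : N ≤ 2) :
    0 ≤ (96 * N ^ 2 - 36 * N ^ 3) + y * (192 + 48 * N + 68 * N ^ 2 - 24 * N ^ 3)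
      + y ^ 2 * (352 + 52 * N + 12 * N ^ 2 - 8 * N ^ 3)
      + y ^ 3 * (300 + 8 * N - 8 * N ^ 2 - 3 * N ^ 3)
      + y ^ 4 * (140 - 8 * N - 6 * N ^ 2) + y ^ 5 * (36 - 4 * N) + 4 * y ^ 6 := by
  have hN3 : N ^ 3 ≤ 2 * N ^ 2 := by nlinarith [mul_nonneg (sq_nonneg N) (sub_nonneg.2 hN2)]
  have hNN : N ^ 2 ≤ 4 := by nlinarith
  have h0 : 0 ≤ 96 * N ^ 2 - 36 * N ^ 3 := by nlinarith
  have h1 : 0 ≤ 192 + 48 * N + 68 * N ^ 2 - 24 * N ^ 3 := by nlinarith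
  have h2 : 0 ≤ 352 + 52 * N + 12 * N ^ 2 - 8 * N ^ 3 := by nlinarith
  have h3 : 0 ≤ 300 + 8 * N - 8 * N ^ 2 - 3 * N ^ 3 := by nlinarith
  have h4 : 0 ≤ 140 - 8 * N - 6 * N ^ 2 := by nlinarith
  have h5 : 0 ≤ 36 - 4 * N := by nlinarith
  positivity

/-- The endpoint case of `scalar_nonneg`, with denominators cleared. Eliminating `β` in favour of `N
= 2β - (1 - β) y`, which lies in `[0, 2]`, leaves a polynomial in `y` whose coefficients are all
nonnegative. -/
theorem boundary_nonneg {β y : ℝ} (hβ0 : 0 < β) (hβ1 : β < 1) (hy : 0 ≤ y)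
    (hN : 0 ≤ 2 * β - (1 - β) * y) :
    0 ≤ (3 * β + y * β) * (2 - β + y) ^ 2
      + (6 * β - 3 - y * (1 + β)) * ((2 * β - (1 - β) * y) * (2 - β + y))
      + ((y * (1 - 3 * β) - 6) / 4) * (2 * β - (1 - β) * y) ^ 2 := by
  obtain ⟨N, hNdef⟩ : ∃ N, N = 2 * β - (1 - β) * y := ⟨_, rfl⟩
  have hN0 : 0 ≤ N := hNdef ▸ hN
  have hh : 0 < 2 + y := by linarith
  have hβ : β = (N + y) / (2 + y) := by rw [eq_div_iff hh.ne']; rw [hNdef]; ring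
  have hN2 : N ≤ 2 := by nlinarith
  have key := boundary_poly_nonneg hy hN0 hN2
  rw [← hNdef]
  have : (3 * β + y * β) * (2 - β + y) ^ 2 + (6 * β - 3 - y * (1 + β)) * (N * (2 - β + y))
      + ((y * (1 - 3 * β) - 6) / 4) * N ^ 2 =
      ((96 * N ^ 2 - 36 * N ^ 3) + y * (192 + 48 * N + 68 * N ^ 2 - 24 * N ^ 3)
      + y ^ 2 * (352 + 52 * N + 12 * N ^ 2 - 8 * N ^ 3)
      + y ^ 3 * (300 + 8 * N - 8 * N ^ 2 - 3 * N ^ 3)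
      + y ^ 4 * (140 - 8 * N - 6 * N ^ 2) + y ^ 5 * (36 - 4 * N) + 4 * y ^ 6)
      / (4 * (2 + y) ^ 3) := by
    rw [hβ]
    field_simp
    ring
  rw [this]
  positivity

/-- The expression is monotone in each of `A₂`, `A₁`, `q` in turn, so they may be replaced by their
extremes `2 A₁ - 3`, `9 / S`, `t² / 4`. What remains is a concave quadratic in `t`, positive at `0`,
to be checked at the largest `t` that `h` permits. -/
theorem scalar_nonneg {β S A₁ A₂ t q : ℝ} (hβ0 : 0 < β) (hβ1 : β < 1) (hS : 3 ≤ S)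
    (hA₁ : 9 ≤ A₁ * S) (hA₂ : 2 * A₁ - 3 ≤ A₂) (ht : 0 < t) (hq : 0 < q)
    (hqt : 4 * q ≤ t ^ 2) (h : t * (S - 1 - β) ≤ 3 - β - (1 - β) * S) :
    0 ≤ β - t * (1 + β) + q + A₁ * (β * t - (1 + β) * q) + β * A₂ * q := by
  obtain ⟨y, rfl⟩ : ∃ y, S = 3 + y := ⟨S - 3, by ring⟩
  have hy : 0 ≤ y := by linarith
  have hD : 0 < 2 - β + y := by linarith
  have htN : t * (2 - β + y) ≤ 2 * β - (1 - β) * y := by linarith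
  have hN : 0 ≤ 2 * β - (1 - β) * y := le_trans (by positivity) htN
  have htT : t ≤ (2 * β - (1 - β) * y) / (2 - β + y) := (le_div_iff₀ hD).2 htN
  have hy1 : (1 - β) * y ≤ 2 * β := by linarith
  have hC : y * (1 - 3 * β) - 6 ≤ 0 := by nlinarith
  have hquad := quadratic_nonneg_of_le (A := 3 * β + y * β) (B := 6 * β - 3 - y * (1 + β))
    (C := (y * (1 - 3 * β) - 6) / 4) (by positivity) (by linarith) ht.le htT (by
      have hb := boundary_nonneg hβ0 hβ1 hy hN
      have : ∀ A B C N D : ℝ, 0 < D → 0 ≤ A * D ^ 2 + B * (N * D) + C * N ^ 2 →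
          0 ≤ A + B * (N / D) + C * (N / D) ^ 2 := by
        intro A B C N D hD h
        have : A + B * (N / D) + C * (N / D) ^ 2
            = (A * D ^ 2 + B * (N * D) + C * N ^ 2) / D ^ 2 := by field_simp
        rw [this]; positivity
      exact this _ _ _ _ _ hD hb)
  have ht2 : t ≤ 2 * β := by nlinarith [mul_nonneg ht.le hy, mul_nonneg (sub_nonneg.2 hβ1.le) hy]
  have htb : t * (2 - β) ≤ 2 * β := by
    nlinarith [mul_nonneg ht.le hy, mul_nonneg (sub_nonneg.2 hβ1.le) hy]
  -- This is the coefficient of `A₁` once `A₂` is replaced by `2 A₁ - 3`.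
  have hP : 0 ≤ β * t - (1 - β) * q := by
    have : (1 - β) * t ≤ 4 * β := by nlinarith
    nlinarith [mul_le_mul_of_nonneg_left hqt (sub_nonneg.2 hβ1.le),
      mul_le_mul_of_nonneg_left this ht.le]
  have h1 : 0 ≤ (3 + y) * (β - t * (1 + β) + q * (1 - 3 * β))
      + 9 * (β * t - (1 - β) * q) := by
    nlinarith [mul_nonneg (neg_nonneg.2 hC) (sub_nonneg.2 hqt)]
  have h2 : 9 * (β * t - (1 - β) * q) ≤ A₁ * (3 + y) * (β * t - (1 - β) * q) :=
    mul_le_mul_of_nonneg_right hA₁ hP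
  have h3 : 0 ≤ (3 + y) * (β - t * (1 + β) + q * (1 - 3 * β)
      + A₁ * (β * t - (1 - β) * q)) := by linarith
  have h4 := nonneg_of_mul_nonneg_right h3 (by linarith : 0 < 3 + y)
  nlinarith [mul_le_mul_of_nonneg_left hA₂ (mul_pos hβ0 hq).le]

/-- The first conclusion is `β` times the second symmetric function of the inverses; the second
makes the contribution of further roots to it nonnegative. -/
theorem five_moduli_nonneg {a b c r s β : ℝ} (ha : 1 < a) (hb : 1 < b) (hc : 1 < c)
    (hr : 0 < r) (hs : 0 < s) (hβ0 : 0 < β) (hβ1 : β < 1)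
    (h : (a * b + b * c + a * c) + (a + b + c) * (r + s) + r * s + β
      ≤ (1 + β) * (a + b + c + (r + s))) :
    0 ≤ 1 + β * ((a⁻¹ * b⁻¹ + b⁻¹ * c⁻¹ + a⁻¹ * c⁻¹) + (a⁻¹ + b⁻¹ + c⁻¹) * (r⁻¹ + s⁻¹) + r⁻¹ * s⁻¹)
      - (1 + β) * (a⁻¹ + b⁻¹ + c⁻¹ + (r⁻¹ + s⁻¹)) ∧
    1 + β ≤ β * (r⁻¹ + s⁻¹) := by
  have ha0 : 0 < a := by linarith
  have hb0 : 0 < b := by linarith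
  have hc0 : 0 < c := by linarith
  have hσ : 2 * (a + b + c) - 3 ≤ a * b + b * c + a * c := by
    nlinarith [mul_pos (sub_pos.2 ha) (sub_pos.2 hb), mul_pos (sub_pos.2 hb) (sub_pos.2 hc),
      mul_pos (sub_pos.2 ha) (sub_pos.2 hc)]
  have hrs := mul_pos hr hs
  -- Drops `r s > 0` and bounds `ab + bc + ac` by `hσ`.
  have ht : (r + s) * ((a + b + c) - 1 - β) ≤ 3 - β - (1 - β) * (a + b + c) := by nlinarith
  have hA : 2 * (a⁻¹ + b⁻¹ + c⁻¹) - 3 ≤ a⁻¹ * b⁻¹ + b⁻¹ * c⁻¹ + a⁻¹ * c⁻¹ := by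
    have h1 := inv_lt_one_of_one_lt₀ ha
    have h2 := inv_lt_one_of_one_lt₀ hb
    have h3 := inv_lt_one_of_one_lt₀ hc
    nlinarith [mul_pos (sub_pos.2 h1) (sub_pos.2 h2), mul_pos (sub_pos.2 h2) (sub_pos.2 h3),
      mul_pos (sub_pos.2 h1) (sub_pos.2 h3)]
  have hAS : 9 ≤ (a⁻¹ + b⁻¹ + c⁻¹) * (a + b + c) := by
    have : (a⁻¹ + b⁻¹ + c⁻¹) * (a + b + c)
        = 9 + ((a - b) ^ 2 / (a * b) + (b - c) ^ 2 / (b * c) + (a - c) ^ 2 / (a * c)) := by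
      field_simp
      ring
    rw [this]
    have : 0 ≤ (a - b) ^ 2 / (a * b) + (b - c) ^ 2 / (b * c) + (a - c) ^ 2 / (a * c) := by
      positivity
    linarith
  have hsum : r⁻¹ + s⁻¹ = (r + s) / (r * s) := by field_simp; ring
  have hprod : r⁻¹ * s⁻¹ = 1 / (r * s) := by field_simp
  have hqt : 4 * (r * s) ≤ (r + s) ^ 2 := by nlinarith [sq_nonneg (r - s)]
  constructor
  · have key := scalar_nonneg hβ0 hβ1 (by linarith : 3 ≤ a + b + c) hAS hA (add_pos hr hs) hrs
      hqt ht
    rw [hsum, hprod]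
    generalize a⁻¹ + b⁻¹ + c⁻¹ = A₁ at *
    generalize a⁻¹ * b⁻¹ + b⁻¹ * c⁻¹ + a⁻¹ * c⁻¹ = A₂ at *
    generalize r + s = t at *
    generalize r * s = q at *
    have : 1 + β * (A₂ + A₁ * (t / q) + 1 / q) - (1 + β) * (A₁ + t / q)
        = (β - t * (1 + β) + q + A₁ * (β * t - (1 + β) * q) + β * A₂ * q) / q := by
      field_simp
      ring
    rw [this]
    positivity
  · rw [hsum, mul_div_assoc', le_div_iff₀ hrs]
    have hts : 0 < r + s := add_pos hr hs
    have hS3 : 3 ≤ a + b + c := by linarith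
    generalize a + b + c = S at *
    generalize r + s = t at *
    have h2 : t * (2 - β) ≤ 2 * β := by
      nlinarith [mul_nonneg hts.le (sub_nonneg.2 hS3),
        mul_nonneg (sub_nonneg.2 hβ1.le) (sub_nonneg.2 hS3)]
    have h3 : (1 + β) * t ≤ 4 * β := by nlinarith
    nlinarith [mul_le_mul_of_nonneg_left h3 hts.le]

/-! ### Reduction from all negative roots to five. -/

/-- `R` and `R₂` are the sum and the sum of squares of the remaining moduli; `R₂ ≤ R ^ 2` allows
their mutual products to be discarded. -/
theorem esymm_two_neg_of_sq_lt {a b c r s R R₂ β : ℝ} (hR : R₂ ≤ R ^ 2)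
    (h : (a + b + c + (r + s) + R - 1 - β) ^ 2
      < a ^ 2 + b ^ 2 + c ^ 2 + (r ^ 2 + s ^ 2) + R₂ + 1 ^ 2 + β ^ 2) :
    (a * b + b * c + a * c) + (a + b + c) * (r + s) + r * s + R * (a + b + c + (r + s)) + β
      - (1 + β) * (a + b + c + (r + s) + R) < 0 := by
  have : (a + b + c + (r + s) + R - 1 - β) ^ 2
      - (a ^ 2 + b ^ 2 + c ^ 2 + (r ^ 2 + s ^ 2) + R ^ 2 + 1 ^ 2 + β ^ 2)
      = 2 * ((a * b + b * c + a * c) + (a + b + c) * (r + s) + r * s + R * (a + b + c + (r + s)) + β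
      - (1 + β) * (a + b + c + (r + s) + R)) := by ring
  linarith

open Finset in
/-- Both hypotheses say that the second elementary symmetric function is negative: of the numbers
`γ i`, `-α`, `-β`, and of their inverses. -/
theorem false_of_three_large_moduli {ι : Type*} [Fintype ι] [DecidableEq ι] {γ : ι → ℝ} {α β : ℝ}
    (hγ : ∀ i, 0 < γ i) (hβ : 0 < β) (hβα : β < α)
    (h : (∑ i, γ i - α - β) ^ 2 < ∑ i, γ i ^ 2 + α ^ 2 + β ^ 2)
    (h' : (∑ i, (γ i)⁻¹ - α⁻¹ - β⁻¹) ^ 2 < ∑ i, (γ i)⁻¹ ^ 2 + α⁻¹ ^ 2 + β⁻¹ ^ 2)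
    {i₁ i₂ i₃ j₁ j₂ : ι} (hnd : [i₁, i₂, i₃, j₁, j₂].Nodup)
    (h₁ : α < γ i₁) (h₂ : α < γ i₂) (h₃ : α < γ i₃) : False := by
  have hα : 0 < α := hβ.trans hβα
  -- Both hypotheses are homogeneous, so everything can be divided by `α`.
  wlog hα1 : α = 1 generalizing γ α β
  · refine this (γ := fun i => γ i / α) (α := 1) (β := β / α) (fun i => div_pos (hγ i) hα)
      (div_pos hβ hα) ((div_lt_one hα).2 hβα) ?_ ?_ ((one_lt_div hα).2 h₁) ((one_lt_div hα).2 h₂)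
      ((one_lt_div hα).2 h₃) one_pos rfl
    · have := mul_lt_mul_of_pos_left h (pow_pos (inv_pos.2 hα) 2)
      simp only [div_eq_mul_inv, mul_pow]
      rw [← sum_mul, ← sum_mul]
      have hαα : α * α⁻¹ = 1 := mul_inv_cancel₀ hα.ne'
      generalize α⁻¹ = α' at *
      linear_combination this + ((2 * ∑ i, γ i - 2 * β) * α') * hαα
    · have := mul_lt_mul_of_pos_left h' (pow_pos hα 2)
      simp only [inv_div, div_eq_mul_inv α, mul_pow]
      rw [← mul_sum, ← mul_sum]
      have hαα : α * α⁻¹ = 1 := mul_inv_cancel₀ hα.ne'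
      generalize α⁻¹ = α' at *
      linear_combination this + ((2 * ∑ i, (γ i)⁻¹ - 2 * β⁻¹) * α) * hαα
  subst hα1
  simp only [List.nodup_cons, List.mem_cons, List.not_mem_nil, or_false, not_or] at hnd
  obtain ⟨⟨h12, h13, h14, h15⟩, ⟨h23, h24, h25⟩, ⟨h34, h35⟩, h45, -⟩ := hnd
  set T : Finset ι := {i₁, i₂, i₃, j₁, j₂} with hT
  have hsplit : ∀ g : ι → ℝ, ∑ i, g i
      = g i₁ + g i₂ + g i₃ + (g j₁ + g j₂) + ∑ i ∈ Tᶜ, g i := by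
    intro g
    rw [← sum_add_sum_compl T, hT, sum_insert (by simp [*]), sum_insert (by simp [*]),
      sum_insert (by simp [*]), sum_insert (by simp [*]), sum_singleton]
    ring
  rw [hsplit, hsplit] at h h'
  have hR : 0 ≤ ∑ i ∈ Tᶜ, γ i := sum_nonneg fun i _ => (hγ i).le
  have hR' : 0 ≤ ∑ i ∈ Tᶜ, (γ i)⁻¹ := sum_nonneg fun i _ => (inv_pos.2 (hγ i)).le
  have hR2 : ∑ i ∈ Tᶜ, γ i ^ 2 ≤ (∑ i ∈ Tᶜ, γ i) ^ 2 :=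
    sum_sq_le_sq_sum_of_nonneg fun i _ => (hγ i).le
  have hR2' : ∑ i ∈ Tᶜ, (γ i)⁻¹ ^ 2 ≤ (∑ i ∈ Tᶜ, (γ i)⁻¹) ^ 2 :=
    sum_sq_le_sq_sum_of_nonneg fun i _ => (inv_pos.2 (hγ i)).le
  have hj₁ := hγ j₁
  have hj₂ := hγ j₂
  generalize γ i₁ = a at *
  generalize γ i₂ = b at *
  generalize γ i₃ = c at *
  generalize γ j₁ = r at *
  generalize γ j₂ = s at *
  generalize ∑ i ∈ Tᶜ, γ i = R at *
  generalize ∑ i ∈ Tᶜ, (γ i)⁻¹ = R' at *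
  obtain ⟨hF, hE⟩ := five_moduli_nonneg h₁ h₂ h₃ hj₁ hj₂ hβ hβα (by
    have : 0 ≤ R * (a + b + c + (r + s) - 1 - β) := mul_nonneg hR (by linarith)
    have := esymm_two_neg_of_sq_lt hR2 h
    linarith)
  have hi : 0 < a⁻¹ + b⁻¹ + c⁻¹ := by
    have : 0 < a := by linarith
    have : 0 < b := by linarith
    have : 0 < c := by linarith
    positivity
  have hE' : 0 ≤ R' * (β * (a⁻¹ + b⁻¹ + c⁻¹ + (r⁻¹ + s⁻¹)) - (1 + β)) :=
    mul_nonneg hR' (by nlinarith [mul_pos hβ hi])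
  rw [inv_one] at h'
  have hββ : β * β⁻¹ = 1 := mul_inv_cancel₀ hβ.ne'
  generalize a⁻¹ = a' at *
  generalize b⁻¹ = b' at *
  generalize c⁻¹ = c' at *
  generalize r⁻¹ = r' at *
  generalize s⁻¹ = s' at *
  generalize β⁻¹ = β' at *
  have h'' := esymm_two_neg_of_sq_lt hR2' h'
  have h3 := mul_neg_of_pos_of_neg hβ h''
  have : β * (((a' * b' + b' * c' + a' * c') + (a' + b' + c') * (r' + s') + r' * s')
      + R' * (a' + b' + c' + (r' + s')) + β' - (1 + β') * (a' + b' + c' + (r' + s') + R'))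
      = 1 + β * ((a' * b' + b' * c' + a' * c') + (a' + b' + c') * (r' + s') + r' * s')
      - (1 + β) * (a' + b' + c' + (r' + s'))
      + R' * (β * (a' + b' + c' + (r' + s')) - (1 + β)) := by
    linear_combination (1 - (a' + b' + c' + (r' + s') + R')) * hββ
  linarith

/-! ### Coefficient signs and symmetric functions of the roots. -/

theorem sigmaPattern_two_two (n : ℕ) : sigmaPattern 2 n 2
    = (List.range (n + 4)).reverse.map fun k => if k < 2 ∨ n + 2 ≤ k then 1 else -1 := by
  apply List.ext_getElem
  · simp [sigmaPattern]
  · intro i h1 h2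
    simp only [sigmaPattern, List.length_map, List.length_reverse, List.length_range,
      List.getElem_append, List.getElem_replicate, List.getElem_map, List.getElem_reverse,
      List.getElem_range, List.length_append, List.length_replicate] at h1 h2 ⊢
    split_ifs <;> first | rfl | omega

theorem signPattern_eq_sigmaPattern_iff {Q : ℝ[X]} (hQ : Q ≠ 0) (n : ℕ) :
    signPattern Q = sigmaPattern 2 n 2 ↔ Q.natDegree = n + 3 ∧
      ∀ k < n + 4, SignType.sign (Q.coeff k) = if k < 2 ∨ n + 2 ≤ k then 1 else -1 := by
  rw [sigmaPattern_two_two, signPattern, coeffList, List.map_map, degree_eq_natDegree hQ]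
  have hs : WithBot.succ ((Q.natDegree : ℕ) : WithBot ℕ) = Q.natDegree + 1 := rfl
  rw [hs]
  constructor
  · intro h
    have hl := congrArg List.length h
    simp only [List.length_map, List.length_reverse, List.length_range] at hl
    have hd : Q.natDegree = n + 3 := by omega
    refine ⟨hd, fun k hk => ?_⟩
    rw [hd, List.map_inj_left] at h
    exact h k (by simpa [Nat.lt_succ_iff] using hk)
  · rintro ⟨hd, h⟩
    rw [hd, List.map_inj_left]
    intro k hk
    exact h k (by simpa [Nat.lt_succ_iff] using hk)

theorem two_mul_esymm_two (s : Multiset ℝ) :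
    2 * s.esymm 2 = s.sum ^ 2 - (s.map (· ^ 2)).sum := by
  induction s using Multiset.induction with
  | empty => simp [Multiset.esymm, Multiset.powersetCard_zero_right 1]
  | cons a s ih =>
    have : (a ::ₘ s).esymm 2 = s.esymm 2 + a * s.sum := by
      simp only [Multiset.esymm, Multiset.powersetCard_cons 1, Multiset.map_add, Multiset.sum_add,
        Multiset.powersetCard_one, Multiset.map_map, Function.comp_def, Multiset.prod_cons,
        Multiset.prod_singleton, Multiset.sum_map_mul_left (f := fun x => x), Multiset.map_id']
    rw [this, Multiset.sum_cons, Multiset.map_cons, Multiset.sum_cons]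
    linear_combination ih

theorem coeff_prod_X_sub_C (s : Multiset ℝ) (hs : ∀ r ∈ s, r ≠ 0) :
    (s.map fun r => X - C r).prod.coeff 0 = (s.map (- ·)).prod ∧
    (s.map fun r => X - C r).prod.coeff 1 = -((s.map (- ·)).prod * (s.map (·⁻¹)).sum) ∧
    2 * (s.map fun r => X - C r).prod.coeff 2
      = (s.map (- ·)).prod * ((s.map (·⁻¹)).sum ^ 2 - (s.map (·⁻¹ ^ 2)).sum) := by
  induction s using Multiset.induction with
  | empty => simp [coeff_one]
  | cons a s ih =>
    obtain ⟨h0, h1, h2⟩ := ih fun r hr => hs r (Multiset.mem_cons_of_mem hr)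
    have ha : a * a⁻¹ = 1 := mul_inv_cancel₀ (hs a (Multiset.mem_cons_self a s))
    simp only [Multiset.map_cons, Multiset.prod_cons, Multiset.sum_cons, sub_mul, coeff_sub,
      coeff_C_mul, coeff_X_mul_zero, coeff_X_mul]
    generalize (s.map (- ·)).prod = p at *
    generalize (s.map (·⁻¹)).sum = e at *
    generalize (s.map (·⁻¹ ^ 2)).sum = f at *
    refine ⟨?_, ?_, ?_⟩
    · rw [h0]; ring
    · rw [h0, h1]; linear_combination -p * ha
    · linear_combination 2 * h1 - a * h2 + 2 * p * e * ha

theorem neg_esymm_two_of_isRealizable {n u v w : ℕ} (hn : 1 ≤ n) (huvw : u + v + w = n + 1)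
    {Q : ℝ[X]} (hQ : Q ≠ 0) (hsign : signPattern Q = sigmaPattern 2 n 2) {α β : ℝ}
    {γ : Fin (u + v + w) → ℝ} (hβ : 0 < β) (hα : 0 < α) (hγ : ∀ i, 0 < γ i)
    (hroots : Q.roots = α ::ₘ β ::ₘ Finset.univ.val.map (fun i => -γ i)) :
    (∑ i, γ i - α - β) ^ 2 < ∑ i, γ i ^ 2 + α ^ 2 + β ^ 2 ∧
    (∑ i, (γ i)⁻¹ - α⁻¹ - β⁻¹) ^ 2 < ∑ i, (γ i)⁻¹ ^ 2 + α⁻¹ ^ 2 + β⁻¹ ^ 2 := by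
  obtain ⟨hd, hc⟩ := (signPattern_eq_sigmaPattern_iff hQ n).1 hsign
  have hcard : Multiset.card Q.roots = Q.natDegree := by
    rw [hroots, hd]; simp [huvw]
  have hlead : 0 < Q.leadingCoeff := by
    have := hc (n + 3) (by omega)
    rw [if_pos (by omega), sign_eq_one_iff] at this
    rwa [leadingCoeff, hd]
  have hneg : ∀ k, 2 ≤ k → k ≤ n + 1 → Q.coeff k < 0 := by
    intro k hk hk'
    have := hc k (by omega)
    rwa [if_neg (by omega), sign_eq_neg_one_iff] at this
  constructor
  · have h := hneg (n + 1) (by omega) le_rfl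
    rw [coeff_eq_esymm_roots_of_card hcard (by omega), hd, show n + 3 - (n + 1) = 2 by omega,
      neg_one_sq, mul_one] at h
    have h2 := two_mul_esymm_two Q.roots
    have h3 : Q.roots.esymm 2 < 0 := neg_of_mul_neg_right h hlead.le
    rw [hroots] at h2 h3
    simp only [Multiset.sum_cons, Multiset.map_cons, Multiset.map_map, Function.comp_def, neg_sq,
      Finset.sum_map_val, Finset.sum_neg_distrib] at h2
    nlinarith
  · have h := hneg 2 le_rfl (by omega)
    rw [← C_leadingCoeff_mul_prod_multiset_X_sub_C hcard, coeff_C_mul] at h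
    have h1 := neg_of_mul_neg_right h hlead.le
    have h2 := (coeff_prod_X_sub_C Q.roots (by
      rw [hroots]
      intro r hr
      simp only [Multiset.mem_cons, Multiset.mem_map] at hr
      rcases hr with rfl | rfl | ⟨i, -, rfl⟩
      · exact hα.ne'
      · exact hβ.ne'
      · exact neg_ne_zero.2 (hγ i).ne')).2.2
    -- The two positive roots contribute two minus signs, which cancel.
    have hp : 0 < (Q.roots.map (- ·)).prod := by
      rw [hroots]
      simp only [Multiset.map_cons, Multiset.prod_cons, Multiset.map_map, Function.comp_def,
        neg_neg, Finset.prod_map_val]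
      have := Finset.prod_pos fun i (_ : i ∈ Finset.univ) => hγ i
      have := mul_pos hα (mul_pos hβ this)
      linarith
    have h3 : (Q.roots.map (·⁻¹)).sum ^ 2 - (Q.roots.map (·⁻¹ ^ 2)).sum < 0 :=
      neg_of_mul_neg_right (by linarith) hp.le
    rw [hroots] at h3
    simp only [Multiset.sum_cons, Multiset.map_cons, Multiset.map_map, Function.comp_def, neg_sq,
      Finset.sum_map_val, Finset.sum_neg_distrib, inv_neg] at h3
    nlinarith

/-! ### Non-realizability. -/

theorem not_isRealizable {n u v w : ℕ} (hn : 4 ≤ n) (huvw : u + v + w = n + 1)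
    (h : 3 ≤ u ∨ 3 ≤ w) : ¬ IsRealizable 2 n 2 u v w := by
  rintro ⟨Q, ⟨hQ, -⟩, hsign, β, α, γ, hβ, hβα, hγ, -, hroots, hu, -, -, hw⟩
  obtain ⟨h1, h2⟩ := neg_esymm_two_of_isRealizable (by omega) huvw hQ hsign hβ (hβ.trans hβα) hγ
    hroots
  have hN : 5 ≤ u + v + w := by omega
  rcases h with h | h
  · have hlt : ∀ i : Fin (u + v + w), (i : ℕ) < u → β⁻¹ < (γ i)⁻¹ := fun i hi =>
      (inv_lt_inv₀ hβ (hγ i)).2 (hu i hi)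
    -- Inversion exchanges the roles of `α` and `β` and of the two inequalities.
    refine false_of_three_large_moduli (γ := fun i => (γ i)⁻¹) (α := β⁻¹) (β := α⁻¹)
      (fun i => inv_pos.2 (hγ i)) (inv_pos.2 (hβ.trans hβα)) ((inv_lt_inv₀ (hβ.trans hβα) hβ).2 hβα)
      (by linarith) (by simp only [inv_inv]; linarith) (i₁ := ⟨0, by omega⟩) (i₂ := ⟨1, by omega⟩)
      (i₃ := ⟨2, by omega⟩) (j₁ := ⟨3, by omega⟩) (j₂ := ⟨4, by omega⟩) (by simp)
      (hlt _ (by simp; omega)) (hlt _ (by simp; omega)) (hlt _ (by simp; omega))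
  · refine false_of_three_large_moduli hγ hβ hβα h1 h2 (i₁ := ⟨u + v + w - 1, by omega⟩)
      (i₂ := ⟨u + v + w - 2, by omega⟩) (i₃ := ⟨u + v + w - 3, by omega⟩) (j₁ := ⟨0, by omega⟩)
      (j₂ := ⟨1, by omega⟩) (by simp; omega) (hw _ ?_) (hw _ ?_) (hw _ ?_) <;> simp <;> omega

/-! ### Realizability from a finite set of moduli. -/

theorem orderEmbOfFin_lt_iff {N : ℕ} (S : Finset ℝ) (hS : S.card = N) (x : ℝ) (i : Fin N) :
    S.orderEmbOfFin hS i < x ↔ (i : ℕ) < (S.filter (· < x)).card := by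
  have hcard : (S.filter (· < x)).card
      = (Finset.univ.filter fun j => S.orderEmbOfFin hS j < x).card := by
    conv_lhs => rw [← Finset.map_orderEmbOfFin_univ S hS]
    rw [Finset.filter_map, Finset.card_map]
    rfl
  rw [hcard]
  constructor
  · intro h
    have : Finset.Iic i ⊆ Finset.univ.filter fun j => S.orderEmbOfFin hS j < x := fun j hj => by
      simpa using ((S.orderEmbOfFin hS).monotone (Finset.mem_Iic.1 hj)).trans_lt h
    have := Finset.card_le_card this
    rw [Fin.card_Iic] at this
    omega
  · intro h
    by_contra hx
    have : (Finset.univ.filter fun j => S.orderEmbOfFin hS j < x) ⊆ Finset.Iio i := fun j hj => by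
      rw [Finset.mem_filter] at hj
      exact Finset.mem_Iio.2 ((S.orderEmbOfFin hS).lt_iff_lt.1 (hj.2.trans_le (not_lt.1 hx)))
    have := Finset.card_le_card this
    rw [Fin.card_Iio] at this
    omega

theorem isRealizable_of_finset {m n q u v w : ℕ} {α β : ℝ} {S : Finset ℝ} (hβ : 0 < β)
    (hβα : β < α) (hS : ∀ s ∈ S, 0 < s) (hβS : β ∉ S) (hαS : α ∉ S) (hcard : S.card = u + v + w)
    (hu : (S.filter (· < β)).card = u) (hv : (S.filter (· < α)).card = u + v)
    (hsign : signPattern ((X - C α) * (X - C β) * ∏ s ∈ S, (X + C s)) = sigmaPattern m n q) :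
    IsRealizable m n q u v w := by
  have hprod : (X - C α) * (X - C β) * ∏ s ∈ S, (X + C s)
      = ((α ::ₘ β ::ₘ S.val.map (- ·)).map fun r => X - C r).prod := by
    simp only [Multiset.map_cons, Multiset.prod_cons, Multiset.map_map, Function.comp_def, map_neg,
      sub_neg_eq_add, mul_assoc, Finset.prod_map_val]
  have hmem : ∀ i, S.orderEmbOfFin hcard i ∈ S := S.orderEmbOfFin_mem hcard
  refine ⟨_, ⟨?_, fun z hz => ?_⟩, hsign, β, α, S.orderEmbOfFin hcard, hβ, hβα,
    fun i => hS _ (hmem i), (S.orderEmbOfFin hcard).strictMono, ?_, fun i hi => ?_, fun i hi => ?_,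
    fun i hi => ?_, fun i hi => ?_⟩
  · refine mul_ne_zero (mul_ne_zero (X_sub_C_ne_zero _) (X_sub_C_ne_zero _)) ?_
    exact Finset.prod_ne_zero_iff.2 fun s _ => X_add_C_ne_zero s
  · simp only [map_mul, map_prod, map_sub, map_add, aeval_X, aeval_C, mul_eq_zero,
      Finset.prod_eq_zero_iff, sub_eq_zero, add_eq_zero_iff_eq_neg] at hz
    rcases hz with (rfl | rfl) | ⟨s, -, rfl⟩ <;> simp
  · rw [hprod, roots_multiset_prod_X_sub_C]
    congr 2
    have hval : S.val = Finset.univ.val.map (S.orderEmbOfFin hcard) := by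
      conv_lhs => rw [← Finset.map_orderEmbOfFin_univ S hcard]
      rfl
    conv_lhs => rw [hval, Multiset.map_map]
    rfl
  · rwa [orderEmbOfFin_lt_iff, hu]
  · refine lt_of_le_of_ne (not_lt.1 fun h => ?_) fun h => hβS (h ▸ hmem i)
    rw [orderEmbOfFin_lt_iff, hu] at h
    omega
  · rwa [orderEmbOfFin_lt_iff, hv]
  · refine lt_of_le_of_ne (not_lt.1 fun h => ?_) fun h => hαS (h ▸ hmem i)
    rw [orderEmbOfFin_lt_iff, hv] at h
    omega

/-- `P` is monic of degree `m + 3` with sign pattern `Σ_{2,m+2}`. -/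
structure HasOneSignChange (P : ℝ[X]) (m : ℕ) : Prop where
  monic : P.Monic
  natDegree : P.natDegree = m + 3
  coeff_pos : 0 < P.coeff (m + 2)
  coeff_neg : ∀ k < m + 2, P.coeff k < 0

/-! ### Concatenation of sign patterns by adding small roots. -/

section SmallRoots

open Filter Topology

/-- As `ε → 0` the product tends to `P * X`, which fixes all signs but that of the constant term `ε
* P.coeff 0`, again negative. -/
theorem HasOneSignChange.eventually_mul_X_add_C {P : ℝ[X]} {m : ℕ} (h : HasOneSignChange P m) :
    ∀ᶠ ε in 𝓝[>] (0 : ℝ), HasOneSignChange (P * (X + C ε)) (m + 1) := by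
  have hcoeff : ∀ ε k, (P * (X + C ε)).coeff (k + 1) = P.coeff k + P.coeff (k + 1) * ε := by
    intro ε k
    rw [mul_add, coeff_add, coeff_mul_X, coeff_mul_C]
  have htend : ∀ k, Tendsto (fun ε => (P * (X + C ε)).coeff (k + 1)) (𝓝[>] 0) (𝓝 (P.coeff k)) := by
    intro k
    simp only [hcoeff]
    have : Continuous fun ε : ℝ => P.coeff k + P.coeff (k + 1) * ε := by fun_prop
    simpa using (this.tendsto 0).mono_left nhdsWithin_le_nhds
  have hneg : ∀ᶠ ε in 𝓝[>] (0 : ℝ), ∀ k ∈ Finset.range (m + 2),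
      (P * (X + C ε)).coeff (k + 1) < 0 :=
    (eventually_all_finset _).2 fun k hk =>
      (htend k).eventually_lt_const (h.coeff_neg k (Finset.mem_range.1 hk))
  filter_upwards [hneg, (htend (m + 2)).eventually_const_lt h.coeff_pos, self_mem_nhdsWithin]
    with ε h1 h2 hε
  refine ⟨h.monic.mul (monic_X_add_C ε), ?_, h2, fun k hk => ?_⟩
  · rw [h.monic.natDegree_mul (monic_X_add_C ε), natDegree_X_add_C, h.natDegree]
  · rcases k with _ | k
    · have h3 : (P * (X + C ε)).coeff 0 = P.coeff 0 * ε := by simp [mul_coeff_zero]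
      rw [h3]
      exact mul_neg_of_neg_of_pos (h.coeff_neg 0 (by omega)) hε
    · exact h1 k (Finset.mem_range.2 (by omega))

theorem coeff_mul_cubic (P : ℝ[X]) (a b c : ℝ) :
    (P * (X ^ 3 + C a * X ^ 2 + C b * X + C c)).coeff 0 = P.coeff 0 * c ∧
    (P * (X ^ 3 + C a * X ^ 2 + C b * X + C c)).coeff 1 = P.coeff 0 * b + P.coeff 1 * c ∧
    (P * (X ^ 3 + C a * X ^ 2 + C b * X + C c)).coeff 2
      = P.coeff 0 * a + P.coeff 1 * b + P.coeff 2 * c ∧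
    ∀ k, (P * (X ^ 3 + C a * X ^ 2 + C b * X + C c)).coeff (k + 3)
      = P.coeff k + P.coeff (k + 1) * a + P.coeff (k + 2) * b + P.coeff (k + 3) * c := by
  have : P * (X ^ 3 + C a * X ^ 2 + C b * X + C c)
      = P * X * X * X + P * C a * X * X + P * C b * X + P * C c := by ring
  rw [this]
  refine ⟨?_, ?_, ?_, fun k => ?_⟩ <;>
    simp only [coeff_add, coeff_mul_X, coeff_mul_X_zero, coeff_mul_C, zero_add]

/-- The conditions on `a, b` give `(X - 1)(X + a)(X + b)` the signs `+ + - -`. Shrinking its roots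
by `ε` appends this pattern, multiplied by the negative sign of `P.coeff 0`, to that of `P`. -/
theorem HasOneSignChange.eventually_signPattern {P : ℝ[X]} {m : ℕ} (h : HasOneSignChange P m)
    {a b : ℝ} (ha : 0 < a) (hb : 0 < b) (hab : 1 < a + b) (hab' : a * b < a + b) :
    ∀ᶠ ε in 𝓝[>] (0 : ℝ),
      signPattern (P * ((X - C ε) * (X + C (ε * a)) * (X + C (ε * b)))) = sigmaPattern 2 (m + 3) 2
      := by
  have hcubic : ∀ ε : ℝ, (X - C ε) * (X + C (ε * a)) * (X + C (ε * b))
      = X ^ 3 + C (ε * (a + b - 1)) * X ^ 2 + C (-(ε ^ 2 * (a + b - a * b))) * X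
        + C (-(ε ^ 3 * (a * b))) := by
    intro ε
    simp only [map_mul, map_add, map_sub, map_neg, map_pow, map_one]
    ring
  have h0 := h.coeff_neg 0 (by omega)
  have htend : ∀ f : ℝ → ℝ, Continuous f → Tendsto f (𝓝[>] 0) (𝓝 (f 0)) := fun f hf =>
    (hf.tendsto 0).mono_left nhdsWithin_le_nhds
  have hk : ∀ k, Tendsto (fun ε : ℝ => P.coeff k + P.coeff (k + 1) * (ε * (a + b - 1))
      + P.coeff (k + 2) * (-(ε ^ 2 * (a + b - a * b))) + P.coeff (k + 3) * (-(ε ^ 3 * (a * b))))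
      (𝓝[>] 0) (𝓝 (P.coeff k)) := by
    intro k
    convert htend (fun ε : ℝ => P.coeff k + P.coeff (k + 1) * (ε * (a + b - 1))
      + P.coeff (k + 2) * (-(ε ^ 2 * (a + b - a * b))) + P.coeff (k + 3) * (-(ε ^ 3 * (a * b))))
      (by fun_prop) using 2
    simp
  have hneg := (eventually_all_finset (Finset.range (m + 2))).2 fun k hk' =>
      (hk k).eventually_lt_const (h.coeff_neg k (Finset.mem_range.1 hk'))
  have hpos := (hk (m + 2)).eventually_const_lt h.coeff_pos
  -- The coefficients of `X ^ 2` and `X` tend to `0`, so they are divided by `ε` and `ε ^ 2` before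
  -- taking limits.
  have h2 := (htend (fun ε : ℝ => P.coeff 0 * (a + b - 1) - P.coeff 1 * ε * (a + b - a * b)
    - P.coeff 2 * ε ^ 2 * (a * b)) (by fun_prop)).eventually_lt_const (u := 0) (by
      simpa using mul_neg_of_neg_of_pos h0 (by linarith : 0 < a + b - 1))
  have h1 := (htend (fun ε : ℝ => P.coeff 0 * (a + b - a * b) + P.coeff 1 * ε * (a * b))
    (by fun_prop)).eventually_lt_const (u := 0) (by
      simpa using mul_neg_of_neg_of_pos h0 (by linarith : 0 < a + b - a * b))
  filter_upwards [hneg, hpos, h1, h2, self_mem_nhdsWithin] with ε hneg hpos h1 h2 (hε : 0 < ε)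
  have hmon : ((X - C ε) * (X + C (ε * a)) * (X + C (ε * b))).Monic :=
    ((monic_X_sub_C _).mul (monic_X_add_C _)).mul (monic_X_add_C _)
  have hdeg : (P * ((X - C ε) * (X + C (ε * a)) * (X + C (ε * b)))).natDegree = m + 3 + 3 := by
    rw [h.monic.natDegree_mul hmon, h.natDegree,
      ((monic_X_sub_C _).mul (monic_X_add_C _)).natDegree_mul (monic_X_add_C _),
      (monic_X_sub_C _).natDegree_mul (monic_X_add_C _), natDegree_X_sub_C, natDegree_X_add_C,
      natDegree_X_add_C]
  rw [signPattern_eq_sigmaPattern_iff (h.monic.mul hmon).ne_zero]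
  refine ⟨hdeg, fun k hk => ?_⟩
  have hlead := (h.monic.mul hmon).coeff_natDegree
  rw [hdeg] at hlead
  rw [hcubic] at hlead ⊢
  obtain ⟨c0, c1, c2, c3⟩ := coeff_mul_cubic P (ε * (a + b - 1)) (-(ε ^ 2 * (a + b - a * b)))
    (-(ε ^ 3 * (a * b)))
  match k, hk with
  | 0, _ =>
    rw [if_pos (by omega), sign_eq_one_iff, c0]
    have : 0 < ε ^ 3 * (a * b) := by positivity
    nlinarith
  | 1, _ =>
    rw [if_pos (by omega), sign_eq_one_iff, c1]
    nlinarith [mul_neg_of_pos_of_neg (pow_pos hε 2) h1]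
  | 2, _ =>
    rw [if_neg (by omega), sign_eq_neg_one_iff, c2]
    nlinarith [mul_neg_of_pos_of_neg hε h2]
  | k + 3, hk =>
    rcases lt_trichotomy k (m + 2) with hkm | rfl | hkm
    · rw [if_neg (by omega), sign_eq_neg_one_iff, c3]
      exact hneg k (Finset.mem_range.2 hkm)
    · rw [if_pos (by omega), sign_eq_one_iff, c3]
      exact hpos
    · obtain rfl : k = m + 3 := by omega
      rw [if_pos (by omega), hlead, sign_one]

theorem hasOneSignChange_cubic {a b : ℝ} (ha : 0 < a) (hb : 0 < b) (hab : 1 < a + b)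
    (hab' : a * b < a + b) : HasOneSignChange ((X - C 1) * (X + C a) * (X + C b)) 0 := by
  have hmon : ((X - C 1) * (X + C a) * (X + C b)).Monic :=
    ((monic_X_sub_C _).mul (monic_X_add_C _)).mul (monic_X_add_C _)
  have hdeg : ((X - C 1) * (X + C a) * (X + C b)).natDegree = 3 := by
    rw [((monic_X_sub_C _).mul (monic_X_add_C _)).natDegree_mul (monic_X_add_C _),
      (monic_X_sub_C _).natDegree_mul (monic_X_add_C _), natDegree_X_sub_C, natDegree_X_add_C,
      natDegree_X_add_C]
  have hcubic : (X - C 1) * (X + C a) * (X + C b)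
      = 1 * (X ^ 3 + C (a + b - 1) * X ^ 2 + C (-(a + b - a * b)) * X + C (-(a * b))) := by
    simp only [map_mul, map_add, map_sub, map_neg, map_one]
    ring
  refine ⟨hmon, hdeg, ?_, ?_⟩
  all_goals
    rw [hcubic, one_mul]
    obtain ⟨c0, c1, c2, -⟩ := coeff_mul_cubic 1 (a + b - 1) (-(a + b - a * b)) (-(a * b))
    simp only [coeff_one, if_true, one_ne_zero, two_ne_zero, if_false, zero_mul, one_mul, add_zero]
      at c0 c1 c2
  · rw [zero_add, c2]; linarith
  · intro k hk
    match k, hk with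
    | 0, _ => rw [c0]; linarith [mul_pos ha hb]
    | 1, _ => rw [c1]; linarith

theorem exists_finset_hasOneSignChange {P : ℝ[X]} (hP : HasOneSignChange P 0) (m : ℕ) :
    ∃ T : Finset ℝ, T.card = m ∧ (∀ c ∈ T, 0 < c ∧ c < 1 / 2) ∧
      HasOneSignChange (P * ∏ c ∈ T, (X + C c)) m := by
  induction m with
  | zero => exact ⟨∅, rfl, by simp, by simpa using hP⟩
  | succ m ih =>
    obtain ⟨T, hT, hT', h⟩ := ih
    have hlt : ∀ᶠ ε in 𝓝[>] (0 : ℝ), ∀ c ∈ T, ε < c := (eventually_all_finset _).2 fun c hc =>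
      nhdsWithin_le_nhds (eventually_lt_nhds (hT' c hc).1)
    have hlt' : ∀ᶠ ε in 𝓝[>] (0 : ℝ), ε < 1 / 2 :=
      nhdsWithin_le_nhds (eventually_lt_nhds (by norm_num))
    obtain ⟨ε, hεT, hε2, hεP, hε⟩ :=
      (hlt.and (hlt'.and (h.eventually_mul_X_add_C.and self_mem_nhdsWithin))).exists
    have hmem : ε ∉ T := fun hm => (hεT ε hm).false
    refine ⟨insert ε T, by rw [Finset.card_insert_of_notMem hmem, hT], ?_, ?_⟩
    · intro c hc
      rcases Finset.mem_insert.1 hc with rfl | hc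
      exacts [⟨hε, hε2⟩, hT' c hc]
    · rw [Finset.prod_insert hmem]
      convert hεP using 1
      ring

theorem exists_pair_near_one {k : ℕ} (hk : k ≤ 2) : ∃ a b : ℝ, 1 / 2 < a ∧ a < b ∧ b < 3 / 2 ∧
    a ≠ 1 ∧ b ≠ 1 ∧ (if a < 1 then 1 else 0) + (if b < 1 then 1 else 0) = k := by
  interval_cases k
  · exact ⟨5 / 4, 4 / 3, by norm_num⟩
  · exact ⟨3 / 4, 5 / 4, by norm_num⟩
  · exact ⟨2 / 3, 3 / 4, by norm_num⟩

theorem isRealizable_of_le_two {n u v w : ℕ} (hn : 4 ≤ n) (huvw : u + v + w = n + 1)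
    (hu : u ≤ 2) (hw : w ≤ 2) : IsRealizable 2 n 2 u v w := by
  obtain ⟨m, rfl⟩ : ∃ m, n = m + 3 := ⟨n - 3, by omega⟩
  -- Of `a, b` exactly `w` must exceed `α = 1`, so `2 - w` lie below it; of `ε a', ε b'` exactly `u`
  -- lie below `β = ε`.
  obtain ⟨a, b, ha, hab, hb, ha1, hb1, hcount⟩ := exists_pair_near_one (k := 2 - w) (by omega)
  obtain ⟨a', b', ha', hab', hb', ha1', hb1', hcount'⟩ := exists_pair_near_one hu
  obtain ⟨T, hT, hTlt, hP⟩ := exists_finset_hasOneSignChange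
    (hasOneSignChange_cubic (a := a) (b := b) (by linarith) (by linarith) (by linarith)
      (by nlinarith)) m
  -- The factor `2` exceeds `b' < 3 / 2`, so the last triple stays below `T`.
  have hlt : ∀ᶠ ε in 𝓝[>] (0 : ℝ), ∀ c ∈ T, 2 * ε < c := (eventually_all_finset _).2 fun c hc => by
    have := eventually_lt_nhds (half_pos (hTlt c hc).1)
    filter_upwards [nhdsWithin_le_nhds this] with ε hε
    linarith
  have hlt' : ∀ᶠ ε in 𝓝[>] (0 : ℝ), ε < 1 / 4 :=
    nhdsWithin_le_nhds (eventually_lt_nhds (by norm_num))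
  obtain ⟨ε, hεT, hε4, hsign, hε : 0 < ε⟩ := (hlt.and (hlt'.and
    ((hP.eventually_signPattern (a := a') (b := b') (by linarith) (by linarith) (by linarith)
      (by nlinarith)).and self_mem_nhdsWithin))).exists
  have hεa : 0 < ε * a' := mul_pos hε (by linarith)
  have hεab : ε * a' < ε * b' := by gcongr
  have hεb : ε * b' < 2 * ε := by nlinarith
  have hbT : ε * b' ∉ T := fun h => by linarith [hεT _ h]
  have haT : ε * a' ∉ insert (ε * b') T := by
    rw [Finset.mem_insert, not_or]
    exact ⟨hεab.ne, fun h => by linarith [hεT _ h]⟩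
  have hbS : b ∉ insert (ε * a') (insert (ε * b') T) := by
    simp only [Finset.mem_insert, not_or]
    exact ⟨by linarith, by linarith, fun h => by linarith [(hTlt _ h).2]⟩
  have haS : a ∉ insert b (insert (ε * a') (insert (ε * b') T)) := by
    simp only [Finset.mem_insert, not_or]
    exact ⟨hab.ne, by linarith, by linarith, fun h => by linarith [(hTlt _ h).2]⟩
  have hεa' : ε * a' < ε ↔ a' < 1 := mul_lt_iff_lt_one_right hε
  have hεb' : ε * b' < ε ↔ b' < 1 := mul_lt_iff_lt_one_right hε
  refine isRealizable_of_finset (α := 1) (β := ε)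
    (S := insert a (insert b (insert (ε * a') (insert (ε * b') T)))) hε (by linarith) ?_ ?_ ?_ ?_
    ?_ ?_ ?_
  · intro s hs
    simp only [Finset.mem_insert] at hs
    rcases hs with rfl | rfl | rfl | rfl | hs
    exacts [by linarith, by linarith, hεa, by linarith, (hTlt s hs).1]
  · simp only [Finset.mem_insert, not_or]
    exact ⟨by linarith, by linarith, fun h => ha1' (by nlinarith), fun h => hb1' (by nlinarith),
      fun h => by linarith [hεT _ h]⟩
  · simp only [Finset.mem_insert, not_or]
    exact ⟨ha1.symm, hb1.symm, by linarith, by linarith, fun h => by linarith [(hTlt _ h).2]⟩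
  · rw [Finset.card_insert_of_notMem haS, Finset.card_insert_of_notMem hbS,
      Finset.card_insert_of_notMem haT, Finset.card_insert_of_notMem hbT, hT]
    omega
  · have hTε : ∑ c ∈ T, (if c < ε then 1 else 0) = 0 :=
      Finset.sum_eq_zero fun c hc => if_neg (by linarith [hεT c hc])
    rw [Finset.card_filter, Finset.sum_insert haS, Finset.sum_insert hbS, Finset.sum_insert haT,
      Finset.sum_insert hbT, hTε, if_neg (by linarith), if_neg (by linarith)]
    simp only [hεa', hεb']
    omega
  · have hT1 : ∑ c ∈ T, (if c < 1 then 1 else 0) = m := by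
      rw [← hT, Finset.card_eq_sum_ones]
      exact Finset.sum_congr rfl fun c hc => if_pos (by linarith [(hTlt c hc).2])
    rw [Finset.card_filter, Finset.sum_insert haS, Finset.sum_insert hbS, Finset.sum_insert haT,
      Finset.sum_insert hbT, hT1, if_pos (by linarith : ε * a' < 1),
      if_pos (by linarith : ε * b' < 1)]
    omega
  · rw [Finset.prod_insert haS, Finset.prod_insert hbS, Finset.prod_insert haT,
      Finset.prod_insert hbT, ← hsign]
    congr 1
    ring

end SmallRoots

/-- The condition `u + v + w = n + 1` is the compatibility with Descartes' rule of signs: the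
polynomials in question have degree `n + 3` and two positive roots. -/
theorem theorem2 (n : ℕ) (hn : 4 ≤ n) (u v w : ℕ) (huvw : u + v + w = n + 1) :
    (u ≤ 2 ∧ w ≤ 2 → IsRealizable 2 n 2 u v w) ∧
    (3 ≤ u ∨ 3 ≤ w → ¬ IsRealizable 2 n 2 u v w) :=
  ⟨fun h => isRealizable_of_le_two hn huvw h.1 h.2, not_isRealizable hn huvw⟩
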